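/- Let $(M,g)$ be a $C^r$ spacetime, $r\in\{3,4,\dots,\infty\}$, of dimension $n\ge 2$: a connected (Hausdorff, second countable) $C^r$ manifold $M$ without boundary, with a $C^{r-1}$ Lorentzian metric $g$ of signature $(-,+,\dots,+)$, time-oriented by a continuous timelike vector field. Causal curves are piecewise $C^1$ curves whose tangent vectors are nonzero, future-directed, and timelike or null; timelike curves are those whose tangent vectors are all timelike. Write $(x,y)\in I^+$ if there is a future-directed timelike curve from $x$ to $y$, and $(x,y)\in J^+$ if $x=y$ or there is a future-directed causal curve from $x$ to $y$. Put $I^+(x)=\{y:(x,y)\in I^+\}$, $I^-(x)=\{y:(y,x)\in I^+\}$ and $$D^+=\{(x,y)\in M\times M:\ y\in\overline{I^+(x)}\ \text{ and }\ x\in\overline{I^-(y)}\}.$$ The spacetime is *weakly distinguishing* if $I^+(x)=I^+(y)$ and $I^-(x)=I^-(y)$ imply $x=y$; *feebly distinguishing* if $(x,y)\in J^+$, $I^+(x)=I^+(y)$ and $I^-(x)=I^-(y)$ imply $x=y$; *causal* if there is no closed causal curve. Then $J^+\subset D^+$. If the spacetime is weakly distinguishing then it is feebly distinguishing, and if it is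 feebly distinguishing then it is causal. -/

import Mathlib

open scoped Manifold ContDiff

/-- A bilinear form on a real vector space of dimension `n` has signature `(-,+,…,+)`: it is
diagonal with entries `-1, 1, …, 1` in some basis. -/
def HasLorentzSignature (n : ℕ) {V : Type*} [AddCommGroup V] [Module ℝ V] (B : V → V → ℝ) : Prop :=
  ∃ b : Module.Basis (Fin n) ℝ V, ∀ i j : Fin n,
    B (b i) (b j) = if i = j then (if (i : ℕ) = 0 then -1 else 1) else 0

/-- The geometric data of a `C^r` spacetime on the `n`-dimensional manifold `M`: a Lorentzian
metric of signature `(-,+,…,+)` and of class `C^(r-1)` (the best class that makes sense for a tensor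
field on a `C^r` manifold; `∞ - 1 = ∞`), and a time orientation, given by a continuous timelike
vector field. -/
structure SpacetimeStructure (n : ℕ) (r : ℕ∞) (M : Type*) [TopologicalSpace M]
    [ChartedSpace (EuclideanSpace ℝ (Fin n)) M] [IsManifold (𝓡 n) 1 M] where
  /-- The metric tensor. -/
  metric : ∀ x : M, TangentSpace (𝓡 n) x →L[ℝ] TangentSpace (𝓡 n) x →L[ℝ] ℝ
  contMDiff_metric :
    ContMDiff (𝓡 n)
      ((𝓡 n).prod 𝓘(ℝ, EuclideanSpace ℝ (Fin n) →L[ℝ] EuclideanSpace ℝ (Fin n) →L[ℝ] ℝ))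
      ((r - 1 : ℕ∞) : WithTop ℕ∞)
      (fun x ↦ Bundle.TotalSpace.mk'
        (EuclideanSpace ℝ (Fin n) →L[ℝ] EuclideanSpace ℝ (Fin n) →L[ℝ] ℝ)
        (E := fun x : M ↦ TangentSpace (𝓡 n) x →L[ℝ] TangentSpace (𝓡 n) x →L[ℝ] ℝ) x (metric x))
  symm_metric : ∀ (x : M) (v w : TangentSpace (𝓡 n) x), metric x v w = metric x w v
  lorentzian : ∀ x : M, HasLorentzSignature n (fun v w : TangentSpace (𝓡 n) x ↦ metric x v w)
  /-- The vector field which defines the time orientation. -/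
  timeField : ∀ x : M, TangentSpace (𝓡 n) x
  continuous_timeField : Continuous (fun x ↦ (⟨x, timeField x⟩ : TangentBundle (𝓡 n) M))
  timelike_timeField : ∀ x : M, metric x (timeField x) (timeField x) < 0

namespace SpacetimeStructure

variable {n : ℕ} {r : ℕ∞} {M : Type*} [TopologicalSpace M]
  [ChartedSpace (EuclideanSpace ℝ (Fin n)) M] [IsManifold (𝓡 n) 1 M]

/-- Future-directed timelike tangent vectors. -/
def IsFutureTimelike (S : SpacetimeStructure n r M) {x : M} (v : TangentSpace (𝓡 n) x) : Prop :=
  S.metric x v v < 0 ∧ S.metric x v (S.timeField x) < 0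

/-- Future-directed causal (timelike or null, nonzero) tangent vectors. -/
def IsFutureCausal (S : SpacetimeStructure n r M) {x : M} (v : TangentSpace (𝓡 n) x) : Prop :=
  v ≠ 0 ∧ S.metric x v v ≤ 0 ∧ S.metric x v (S.timeField x) < 0

/-- The velocity at the parameter `t` of a curve on `[a, b]` (one-sided at the endpoints). -/
noncomputable def velocity (n : ℕ) {M : Type*} [TopologicalSpace M]
    [ChartedSpace (EuclideanSpace ℝ (Fin n)) M] (γ : ℝ → M) (a b t : ℝ) :
    TangentSpace (𝓡 n) (γ t) :=
  mfderivWithin 𝓘(ℝ, ℝ) (𝓡 n) γ (Set.Icc a b) t (1 : ℝ)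

/-- `γ` is a `C^1` future-directed timelike curve on `[a, b]`, up to and including the endpoints. -/
structure IsTimelikeSegment (S : SpacetimeStructure n r M) (γ : ℝ → M) (a b : ℝ) : Prop where
  lt : a < b
  contMDiffOn : ContMDiffOn 𝓘(ℝ, ℝ) (𝓡 n) 1 γ (Set.Icc a b)
  future : ∀ t ∈ Set.Icc a b, S.IsFutureTimelike (velocity n γ a b t)

/-- `γ` is a `C^1` future-directed causal curve on `[a, b]`, up to and including the endpoints. -/
structure IsCausalSegment (S : SpacetimeStructure n r M) (γ : ℝ → M) (a b : ℝ) : Prop where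
  lt : a < b
  contMDiffOn : ContMDiffOn 𝓘(ℝ, ℝ) (𝓡 n) 1 γ (Set.Icc a b)
  future : ∀ t ∈ Set.Icc a b, S.IsFutureCausal (velocity n γ a b t)

/-- `S.IsTimelikeCurve γ a b`: `γ` is a piecewise `C^1` future-directed timelike curve on `[a, b]`
(finitely many pieces). -/
inductive IsTimelikeCurve (S : SpacetimeStructure n r M) (γ : ℝ → M) (a : ℝ) : ℝ → Prop
  | single {b : ℝ} : S.IsTimelikeSegment γ a b → IsTimelikeCurve S γ a b
  | append {b c : ℝ} : IsTimelikeCurve S γ a b → S.IsTimelikeSegment γ b c →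
      IsTimelikeCurve S γ a c

/-- `S.IsCausalCurve γ a b`: `γ` is a piecewise `C^1` future-directed causal curve on `[a, b]`
(finitely many pieces). -/
inductive IsCausalCurve (S : SpacetimeStructure n r M) (γ : ℝ → M) (a : ℝ) : ℝ → Prop
  | single {b : ℝ} : S.IsCausalSegment γ a b → IsCausalCurve S γ a b
  | append {b c : ℝ} : IsCausalCurve S γ a b → S.IsCausalSegment γ b c →
      IsCausalCurve S γ a c

/-- The chronological relation `I⁺ ⊆ M × M`. -/
def chronRel (S : SpacetimeStructure n r M) : Set (M × M) :=
  {p | ∃ (γ : ℝ → M) (a b : ℝ), S.IsTimelikeCurve γ a b ∧ γ a = p.1 ∧ γ b = p.2}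

/-- The causal relation `J⁺ ⊆ M × M`. -/
def causalRel (S : SpacetimeStructure n r M) : Set (M × M) :=
  {p | p.1 = p.2 ∨ ∃ (γ : ℝ → M) (a b : ℝ), S.IsCausalCurve γ a b ∧ γ a = p.1 ∧ γ b = p.2}

/-- The chronological future `I⁺(x)`. -/
def chronFuture (S : SpacetimeStructure n r M) (x : M) : Set M := {y | (x, y) ∈ S.chronRel}

/-- The chronological past `I⁻(x)`. -/
def chronPast (S : SpacetimeStructure n r M) (x : M) : Set M := {y | (y, x) ∈ S.chronRel}

/-- The relation `D⁺_f`. -/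
def futureDRel (S : SpacetimeStructure n r M) : Set (M × M) :=
  {p | p.2 ∈ closure (S.chronFuture p.1)}

/-- The relation `D⁺_p`. -/
def pastDRel (S : SpacetimeStructure n r M) : Set (M × M) :=
  {p | p.1 ∈ closure (S.chronPast p.2)}

/-- The relation `D⁺ = D⁺_p ∩ D⁺_f`. -/
def dRel (S : SpacetimeStructure n r M) : Set (M × M) := S.pastDRel ∩ S.futureDRel

/-- Weak distinction: events with the same chronological future and past coincide. -/
def WeaklyDistinguishing (S : SpacetimeStructure n r M) : Prop :=
  ∀ x y : M, S.chronFuture x = S.chronFuture y → S.chronPast x = S.chronPast y → x = y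

/-- Feeble distinction: causally related events with the same chronological future and past
coincide. -/
def FeeblyDistinguishing (S : SpacetimeStructure n r M) : Prop :=
  ∀ x y : M, (x, y) ∈ S.causalRel →
    S.chronFuture x = S.chronFuture y → S.chronPast x = S.chronPast y → x = y

/-- Causality: there is no closed causal curve. -/
def Causal (S : SpacetimeStructure n r M) : Prop :=
  ¬ ∃ (γ : ℝ → M) (a b : ℝ), S.IsCausalCurve γ a b ∧ γ a = γ b

end SpacetimeStructure

/-! The core is a push-up argument that needs no geodesics or convex neighbourhoods. In a chart let
`c` be a causal curve and `T` the time direction at its start, frozen as a constant vector. For `q`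
close to `c a`, put `σ = c + (q - c a) + h • T` with `h(s) = δ (exp (k (s - a)) - 1)`. The metric is
locally Lipschitz, so moving from `c` to `σ` costs at most a constant times the displacement, which
is bounded by a multiple of `h + δ`. The added velocity `h' • T` gains at least a constant times `h'
= k (h + δ)`. For `k` large the gain wins, and `σ` is timelike, starts at `q` and ends near `c` once
`δ` is small (`exists_timelike_near_causal`).

Hence, along a causal segment, membership in the closure of `I⁺(x)` persists for a short time;
continuous induction carries it to the endpoint. Since `x` itself lies in that closure, `y` does
whenever `(x, y) ∈ J⁺`. Time reversal gives the statement for pasts, so `J⁺ ⊆ D⁺`.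

If moreover `z ∈ I⁺(y)`, the open set `I⁻(z)` contains `y` and so meets `I⁺(x)`: thus `I⁺(y) ⊆
I⁺(x)`, and dually for pasts. Two points on a closed causal curve precede each other, hence share
both future and past; as the curve is not constant, feeble distinction fails. Weak distinction
implies feeble distinction by dropping a premise. -/

open Set Filter Topology

/-! ### Perturbation of causal and timelike curves in a vector space -/

section LocalCausality

variable {E : Type*} [NormedAddCommGroup E] [NormedSpace ℝ E]

/-- A vector `v` at `u` is future-directed timelike for a bilinear form `G` and a vector field `τ`
given on a vector space. -/
def IsLocalTimelike (G : E → E →L[ℝ] E →L[ℝ] ℝ) (τ : E → E) (u v : E) : Prop :=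
  G u v v < 0 ∧ G u v (τ u) < 0

/-- Membership in the set of future-directed timelike vectors over an open set is stable. -/
theorem IsLocalTimelike.eventually {G : E → E →L[ℝ] E →L[ℝ] ℝ} {τ : E → E} {u v : E}
    (h : IsLocalTimelike G τ u v) (hG : ContinuousAt G u) (hτ : ContinuousAt τ u) :
    ∀ᶠ p : E × E in 𝓝 (u, v), IsLocalTimelike G τ p.1 p.2 := by
  have hG' : ContinuousAt (fun p : E × E ↦ G p.1) (u, v) :=
    ContinuousAt.comp (f := Prod.fst) (x := (u, v)) hG continuousAt_fst
  have hτ' : ContinuousAt (fun p : E × E ↦ τ p.1) (u, v) :=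
    ContinuousAt.comp (f := Prod.fst) (x := (u, v)) hτ continuousAt_fst
  have h1 : ContinuousAt (fun p : E × E ↦ G p.1 p.2 p.2) (u, v) :=
    (hG'.clm_apply continuousAt_snd).clm_apply continuousAt_snd
  have h2 : ContinuousAt (fun p : E × E ↦ G p.1 p.2 (τ p.1)) (u, v) :=
    (hG'.clm_apply continuousAt_snd).clm_apply hτ'
  exact (h1.eventually_lt continuousAt_const h.1).and (h2.eventually_lt continuousAt_const h.2)

/-- Adding a sufficiently large multiple of a timelike vector `T` to a vector which is causal at a
nearby point gives a timelike vector. -/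
theorem add_smul_timelike {B B' : E →L[ℝ] E →L[ℝ] ℝ} (hsymm : ∀ v w, B v w = B w v)
    {v T : E} {d m N k : ℝ} (hB : ‖B - B'‖ ≤ d) (hv : ‖v‖ ≤ N) (hcausal : B' v v ≤ 0)
    (hvT : B v T ≤ -m) (hTT : B T T ≤ 0) (hk : 0 ≤ k) (hd : d * N ^ 2 < 2 * k * m) :
    B (v + k • T) (v + k • T) < 0 := by
  -- Causal term, error from changing the form, linear gain, and a nonpositive quadratic term: only
  -- the error must be beaten, by the linear gain `-2km`.
  have e : B (v + k • T) (v + k • T) = B' v v + (B - B') v v + 2 * k * B v T + k ^ 2 * B T T := by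
    simp only [map_add, map_smul, _root_.add_apply, _root_.smul_apply,
      smul_eq_mul, _root_.sub_apply, hsymm T v]
    ring
  have h1 : (B - B') v v ≤ d * N ^ 2 := by
    have h2 := (le_abs_self _).trans ((B - B').le_opNorm₂ v v)
    have h3 : ‖B - B'‖ * ‖v‖ * ‖v‖ ≤ d * N * N := by
      have : 0 ≤ d := le_trans (norm_nonneg (B - B')) hB
      have : 0 ≤ N := (norm_nonneg v).trans hv
      gcongr
    calc _ ≤ _ := h2
      _ ≤ _ := h3
      _ = _ := by ring
  rw [e]
  have h4 : 2 * k * B v T ≤ 2 * k * -m := mul_le_mul_of_nonneg_left hvT (by linarith)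
  have h5 : k ^ 2 * B T T ≤ 0 := mul_nonpos_of_nonneg_of_nonpos (sq_nonneg _) hTT
  nlinarith

/-- A causal curve in a vector space with a `C^1` bilinear form can be approximated, for short
times, by timelike curves with prescribed nearby initial points. -/
theorem exists_timelike_near_causal {G : E → E →L[ℝ] E →L[ℝ] ℝ} {τ : E → E} {U : Set E}
    {c : ℝ → E} {a b : ℝ} (hab : a < b)
    (hU : U ∈ 𝓝 (c a)) (hG : ContDiffAt ℝ 1 G (c a)) (hτ : ContinuousAt τ (c a))
    (hsymm : ∀ u ∈ U, ∀ v w, G u v w = G u w v)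
    (hT : G (c a) (τ (c a)) (τ (c a)) < 0)
    (hc : ContDiffOn ℝ 1 c (Icc a b))
    (hnull : ∀ t ∈ Icc a b, G (c t) (derivWithin c (Icc a b) t) (derivWithin c (Icc a b) t) ≤ 0)
    (hfut : G (c a) (derivWithin c (Icc a b) a) (τ (c a)) < 0) :
    ∀ᶠ t in 𝓝[>] a, ∀ ε > 0, ∃ δ > 0, ∀ q, ‖q - c a‖ < δ → ∃ σ : ℝ → E,
      ContDiffOn ℝ 1 σ (Icc a t) ∧ σ a = q ∧ ‖σ t - c t‖ < ε ∧
      ∀ s ∈ Icc a t, σ s ∈ U ∧ IsLocalTimelike G τ (σ s) (derivWithin σ (Icc a t) s) := by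
  set T := τ (c a) with hTdef
  set v₀ := derivWithin c (Icc a b) a with hv₀
  obtain ⟨m, hm, hm'⟩ : ∃ m > 0, G (c a) v₀ T < -m :=
    ⟨-(G (c a) v₀ T) / 2, by linarith, by linarith⟩
  obtain ⟨L, W, hW, hL⟩ := hG.exists_lipschitzOnWith
  have hGc : ContinuousAt G (c a) := hG.continuousAt
  have hev : ∀ᶠ p : E × E in 𝓝 (c a, v₀), (p.1 ∈ U ∧ p.1 ∈ W) ∧ G p.1 p.2 T < -m ∧
      G p.1 T T < 0 ∧ G p.1 p.2 (τ p.1) < 0 ∧ G p.1 T (τ p.1) < 0 := by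
    have hG' : ContinuousAt (fun p : E × E ↦ G p.1) (c a, v₀) :=
      ContinuousAt.comp (f := Prod.fst) (x := (c a, v₀)) hGc continuousAt_fst
    have hτ' : ContinuousAt (fun p : E × E ↦ τ p.1) (c a, v₀) :=
      ContinuousAt.comp (f := Prod.fst) (x := (c a, v₀)) hτ continuousAt_fst
    have hf : Tendsto (Prod.fst : E × E → E) (𝓝 (c a, v₀)) (𝓝 (c a)) := continuousAt_fst
    refine ((hf.eventually hU).and (hf.eventually hW)).and (Eventually.and ?_
      (Eventually.and ?_ (Eventually.and ?_ ?_)))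
    · exact ((hG'.clm_apply continuousAt_snd).clm_apply continuousAt_const).eventually_lt
        continuousAt_const hm'
    · exact ((hG'.clm_apply continuousAt_const).clm_apply continuousAt_const).eventually_lt
        continuousAt_const hT
    · exact ((hG'.clm_apply continuousAt_snd).clm_apply hτ').eventually_lt
        continuousAt_const hfut
    · exact ((hG'.clm_apply continuousAt_const).clm_apply hτ').eventually_lt
        continuousAt_const hT
  obtain ⟨ρ, hρ, hball⟩ := Metric.eventually_nhds_iff_ball.1 hev
  have key : ∀ u v, ‖u - c a‖ < ρ → ‖v - v₀‖ < ρ → (u ∈ U ∧ u ∈ W) ∧ G u v T < -m ∧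
      G u T T < 0 ∧ G u v (τ u) < 0 ∧ G u T (τ u) < 0 := fun u v hu hv ↦
    hball (u, v) (by rw [← ball_prod_same]; simpa [dist_eq_norm] using ⟨hu, hv⟩)
  have ha : a ∈ Icc a b := left_mem_Icc.2 hab.le
  have hc' : ContinuousOn (derivWithin c (Icc a b)) (Icc a b) :=
    hc.continuousOn_derivWithin (uniqueDiffOn_Icc hab) le_rfl
  have hnear : ∀ᶠ t in 𝓝[Icc a b] a, ‖c t - c a‖ < ρ / 2 ∧ ‖derivWithin c (Icc a b) t - v₀‖ < ρ := by
    have h1 := (hc.continuousOn a ha) (Metric.ball_mem_nhds (c a) (half_pos hρ))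
    have h2 := (hc' a ha) (Metric.ball_mem_nhds v₀ hρ)
    filter_upwards [h1, h2] with t h1 h2
    exact ⟨by simpa [dist_eq_norm] using h1, by simpa [dist_eq_norm] using h2⟩
  obtain ⟨η, hη, hnear⟩ := Metric.mem_nhdsWithin_iff.1 hnear
  have hmin : a < min b (a + η) := lt_min hab (by linarith)
  filter_upwards [Ioo_mem_nhdsGT hmin] with t ht ε hε
  have hat : a < t := ht.1
  have htb : t < b := ht.2.trans_le (min_le_left _ _)
  have htη : t < a + η := ht.2.trans_le (min_le_right _ _)
  have hsub : Icc a t ⊆ Icc a b := Icc_subset_Icc_right htb.le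
  have hnear' : ∀ s ∈ Icc a t, ‖c s - c a‖ < ρ / 2 ∧ ‖derivWithin c (Icc a b) s - v₀‖ < ρ := by
    intro s hs
    refine hnear ⟨?_, hsub hs⟩
    rw [Metric.mem_ball, Real.dist_eq, abs_of_nonneg (by linarith [hs.1])]
    linarith [hs.2]
  set N := ‖v₀‖ + ρ with hN
  have hN0 : 0 ≤ N := by positivity
  -- `k` depends on the curve and the metric but not on `δ`, so `δ` can be chosen afterwards; the `+
  -- 1` makes the next inequality strict.
  set k : ℝ := L * (1 + ‖T‖) * N ^ 2 / (2 * m) + 1 with hk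
  have hk0 : 0 < k := by positivity
  have hkm : L * (1 + ‖T‖) * N ^ 2 < 2 * k * m := by
    rw [hk]; field_simp; linarith
  obtain ⟨δ, hδ, hδ'⟩ : ∃ δ > 0, δ * ((1 + ‖T‖) * Real.exp (k * (t - a))) < min (ρ / 2) ε := by
    have hpos : 0 < (1 + ‖T‖) * Real.exp (k * (t - a)) := by positivity
    have hmn : 0 < min (ρ / 2) ε := lt_min (half_pos hρ) hε
    refine ⟨min (ρ / 2) ε / 2 / ((1 + ‖T‖) * Real.exp (k * (t - a))), by positivity, ?_⟩
    rw [div_mul_cancel₀ _ hpos.ne']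
    exact half_lt_self hmn
  refine ⟨δ, hδ, fun q hq ↦ ?_⟩
  -- The solution of `h' = k (h + δ)` with `h a = 0`: its growth rate is proportional to the bound
  -- on the displacement.
  set h : ℝ → ℝ := fun s ↦ δ * (Real.exp (k * (s - a)) - 1) with hh
  have hhd : ∀ s, HasDerivAt h (δ * (k * Real.exp (k * (s - a)))) s := by
    intro s
    have h1 : HasDerivAt (fun s ↦ k * (s - a)) k s := by
      simpa using ((hasDerivAt_id s).sub_const a).const_mul k
    have h2 := (h1.exp.sub_const 1).const_mul δ
    exact h2.congr_deriv (by ring)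
  have hclose : ∀ s ∈ Icc a t, ‖(q - c a) + h s • T‖ ≤ δ * ((1 + ‖T‖) * Real.exp (k * (s - a))) := by
    intro s hs
    have h1 : 1 ≤ Real.exp (k * (s - a)) :=
      Real.one_le_exp (mul_nonneg hk0.le (by linarith [hs.1]))
    have h2 : ‖h s • T‖ = h s * ‖T‖ := by
      rw [norm_smul, Real.norm_of_nonneg (mul_nonneg hδ.le (by linarith))]
    calc _ ≤ ‖q - c a‖ + ‖h s • T‖ := norm_add_le _ _
      _ ≤ δ + h s * ‖T‖ := by rw [h2]; linarith
      _ ≤ δ * (Real.exp (k * (s - a)) + ‖T‖ * Real.exp (k * (s - a))) := by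
        have := norm_nonneg T
        simp only [hh]
        nlinarith [mul_nonneg hδ.le this]
      _ = _ := by ring
  have hmono : ∀ s ∈ Icc a t, Real.exp (k * (s - a)) ≤ Real.exp (k * (t - a)) := by
    intro s hs
    gcongr
    exact hs.2
  have hclose' : ∀ s ∈ Icc a t, ‖(q - c a) + h s • T‖ < min (ρ / 2) ε := by
    intro s hs
    refine ((hclose s hs).trans ?_).trans_lt hδ'
    gcongr
    exact hs.2
  refine ⟨fun s ↦ c s + ((q - c a) + h s • T), ?_, ?_, ?_, ?_⟩
  · refine (hc.mono hsub).add (ContDiff.contDiffOn ?_)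
    have : ContDiff ℝ 1 h := by
      simp only [hh]; fun_prop
    fun_prop
  · simp [hh]
  · have := (hclose' t (right_mem_Icc.2 hat.le)).trans_le (min_le_right _ _)
    simpa using this
  · intro s hs
    set v := derivWithin c (Icc a b) s with hv
    set κ := δ * (k * Real.exp (k * (s - a))) with hκ
    have hκ0 : 0 < κ := by positivity
    have hder : derivWithin (fun s ↦ c s + ((q - c a) + h s • T)) (Icc a t) s = v + κ • T := by
      have h1 : HasDerivWithinAt c v (Icc a t) s :=
        ((hc.differentiableOn one_ne_zero s (hsub hs)).hasDerivWithinAt).mono hsub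
      have h2 : HasDerivWithinAt (fun s ↦ (q - c a) + h s • T) (κ • T) (Icc a t) s :=
        (((hhd s).smul_const T).const_add (q - c a)).hasDerivWithinAt
      exact (h1.add h2).derivWithin (uniqueDiffOn_Icc hat s hs)
    rw [hder]
    obtain ⟨hn1, hn2⟩ := hnear' s hs
    have hsmall := (hclose' s hs).trans_le (min_le_left _ _)
    have hσ : ‖c s + ((q - c a) + h s • T) - c a‖ < ρ := by
      calc _ = ‖(c s - c a) + ((q - c a) + h s • T)‖ := by congr 1; abel
        _ ≤ _ := norm_add_le _ _
        _ < ρ := by linarith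
    obtain ⟨⟨hσU, hσW⟩, k1, k2, k3, k4⟩ := key _ v hσ hn2
    obtain ⟨⟨-, hcW⟩, -⟩ := key (c s) v (by linarith) hn2
    refine ⟨hσU, ?_, ?_⟩
    · refine add_smul_timelike (B' := G (c s)) (hsymm _ hσU)
        (d := L * (δ * ((1 + ‖T‖) * Real.exp (k * (s - a))))) (N := N) (m := m)
        ?_ ?_ (hnull s (hsub hs)) k1.le k2.le hκ0.le ?_
      · have h1 := hL.dist_le_mul _ hσW _ hcW
        rw [dist_eq_norm, dist_eq_norm, add_sub_cancel_left] at h1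
        exact h1.trans (mul_le_mul_of_nonneg_left (hclose s hs) L.2)
      · calc ‖v‖ = ‖v₀ + (v - v₀)‖ := by congr 1; abel
          _ ≤ _ := norm_add_le _ _
          _ ≤ N := by linarith
      · have hp : 0 < δ * Real.exp (k * (s - a)) := by positivity
        have := mul_lt_mul_of_pos_left hkm hp
        rw [hκ]
        linarith
    · rw [map_add, map_smul, _root_.add_apply, _root_.smul_apply,
        smul_eq_mul]
      have := mul_neg_of_pos_of_neg hκ0 k4
      linarith

/-- The endpoint of a timelike curve in a vector space can be moved freely to nearby points, by
changing the curve only close to its end. -/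
theorem exists_timelike_to_nearby_endpoint {G : E → E →L[ℝ] E →L[ℝ] ℝ} {τ : E → E} {U : Set E}
    {c : ℝ → E} {a b : ℝ} (hab : a < b)
    (hU : U ∈ 𝓝 (c b)) (hG : ContinuousAt G (c b)) (hτ : ContinuousAt τ (c b))
    (hc : ContDiffOn ℝ 1 c (Icc a b))
    (htl : IsLocalTimelike G τ (c b) (derivWithin c (Icc a b) b)) :
    ∃ s ∈ Ioo a b, ∀ᶠ q in 𝓝 (c b), ∃ σ : ℝ → E,
      ContDiffOn ℝ 1 σ (Icc s b) ∧ σ s = c s ∧ σ b = q ∧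
      ∀ t ∈ Icc s b, σ t ∈ U ∧ IsLocalTimelike G τ (σ t) (derivWithin σ (Icc s b) t) := by
  have hf : Tendsto (Prod.fst : E × E → E) (𝓝 (c b, derivWithin c (Icc a b) b)) (𝓝 (c b)) :=
    continuousAt_fst
  obtain ⟨ρ, hρ, hball⟩ := Metric.eventually_nhds_iff_ball.1
    ((hf.eventually hU).and (htl.eventually hG hτ))
  have hb : b ∈ Icc a b := right_mem_Icc.2 hab.le
  have hc' : ContinuousOn (derivWithin c (Icc a b)) (Icc a b) :=
    hc.continuousOn_derivWithin (uniqueDiffOn_Icc hab) le_rfl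
  have hnear := ((hc.continuousOn b hb).prodMk (hc' b hb)) (Metric.ball_mem_nhds _ (half_pos hρ))
  obtain ⟨η, hη, hnear⟩ := Metric.mem_nhdsWithin_iff.1 hnear
  obtain ⟨s, hs1, hs2⟩ := exists_between (max_lt hab (sub_lt_self b hη))
  have has : a < s := (le_max_left _ _).trans_lt hs1
  have hbs : b - η < s := (le_max_right _ _).trans_lt hs1
  refine ⟨s, ⟨has, hs2⟩, ?_⟩
  have hl : 0 < b - s := sub_pos.2 hs2
  have hsub : Icc s b ⊆ Icc a b := Icc_subset_Icc_left has.le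
  -- The correction is a linear ramp on `[s, b]`. With `s` already fixed, its slope tends to zero as
  -- `q` tends to `c b`.
  have hw : ∀ᶠ q in 𝓝 (c b), ‖q - c b‖ < ρ / 2 ∧ ‖(b - s)⁻¹ • (q - c b)‖ < ρ / 2 := by
    have h1 : ContinuousAt (fun q ↦ ‖q - c b‖) (c b) := by fun_prop
    have h2 : ContinuousAt (fun q ↦ ‖(b - s)⁻¹ • (q - c b)‖) (c b) := by fun_prop
    exact (h1.eventually_lt continuousAt_const (by simpa using hρ)).and
      (h2.eventually_lt continuousAt_const (by simpa using hρ))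
  filter_upwards [hw] with q ⟨hq1, hq2⟩
  have hder : ∀ t ∈ Icc s b, HasDerivWithinAt (fun t ↦ c t + ((t - s) / (b - s)) • (q - c b))
      (derivWithin c (Icc a b) t + (b - s)⁻¹ • (q - c b)) (Icc s b) t := by
    intro t ht
    have h1 := ((hc.differentiableOn one_ne_zero t (hsub ht)).hasDerivWithinAt).mono hsub
    have h2 : HasDerivAt (fun t ↦ (t - s) / (b - s)) (b - s)⁻¹ t := by
      simpa using ((hasDerivAt_id t).sub_const s).div_const (b - s)
    exact h1.add (h2.smul_const (q - c b)).hasDerivWithinAt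
  refine ⟨fun t ↦ c t + ((t - s) / (b - s)) • (q - c b), ?_, by simp, by simp [hl.ne'], ?_⟩
  · exact (hc.mono hsub).add (ContDiff.contDiffOn (by fun_prop))
  · intro t ht
    rw [(hder t ht).derivWithin (uniqueDiffOn_Icc hs2 t ht)]
    have hn := hnear ⟨by
      rw [Metric.mem_ball, Real.dist_eq, abs_sub_comm, abs_of_nonneg (by linarith [ht.2])]
      linarith [ht.1], hsub ht⟩
    rw [mem_preimage, ← ball_prod_same] at hn
    have hn1 : ‖c t - c b‖ < ρ / 2 := by simpa [dist_eq_norm] using hn.1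
    have hn2 : ‖derivWithin c (Icc a b) t - derivWithin c (Icc a b) b‖ < ρ / 2 := by
      simpa [dist_eq_norm] using hn.2
    have hfrac : ‖((t - s) / (b - s)) • (q - c b)‖ ≤ ‖q - c b‖ := by
      rw [norm_smul, Real.norm_of_nonneg (div_nonneg (by linarith [ht.1]) hl.le)]
      exact mul_le_of_le_one_left (norm_nonneg _) ((div_le_one hl).2 (by linarith [ht.2]))
    refine hball (_, _) ?_
    rw [← ball_prod_same]
    refine ⟨?_, ?_⟩
    · rw [Metric.mem_ball, dist_eq_norm, add_sub_right_comm]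
      exact (norm_add_le _ _).trans_lt (by linarith)
    · rw [Metric.mem_ball, dist_eq_norm, add_sub_right_comm]
      exact (norm_add_le _ _).trans_lt (by linarith)

end LocalCausality

namespace SpacetimeStructure

open Bundle

/-! ### The spacetime read in a chart -/

section Coordinates

variable {n : ℕ} {r : ℕ∞} {M : Type*} [TopologicalSpace M]
  [ChartedSpace (EuclideanSpace ℝ (Fin n)) M] [IsManifold (𝓡 n) 1 M]

local notation "𝔼" n => EuclideanSpace ℝ (Fin n)

/-- The coordinate frame of the tangent bundle given by the chart at `p`. -/
noncomputable def coordFrame (p x : M) : (𝔼 n) →L[ℝ] (𝔼 n) :=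
  (trivializationAt (𝔼 n) (TangentSpace (𝓡 n)) p).symmL ℝ x

/-- The metric in the coordinates given by the chart at `p`. -/
noncomputable def coordMetric (S : SpacetimeStructure n r M) (p : M) (u : 𝔼 n) :
    (𝔼 n) →L[ℝ] (𝔼 n) →L[ℝ] ℝ :=
  ContinuousLinearMap.bilinearComp
    (show (𝔼 n) →L[ℝ] (𝔼 n) →L[ℝ] ℝ from S.metric ((extChartAt (𝓡 n) p).symm u))
    (coordFrame p ((extChartAt (𝓡 n) p).symm u)) (coordFrame p ((extChartAt (𝓡 n) p).symm u))

/-- The time orientation in the coordinates given by the chart at `p`. -/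
noncomputable def coordTimeField (S : SpacetimeStructure n r M) (p : M) (u : 𝔼 n) : 𝔼 n :=
  (trivializationAt (𝔼 n) (TangentSpace (𝓡 n)) p
    ⟨(extChartAt (𝓡 n) p).symm u, S.timeField ((extChartAt (𝓡 n) p).symm u)⟩).2

theorem coordMetric_apply (S : SpacetimeStructure n r M) (p : M) (u v w : 𝔼 n) :
    S.coordMetric p u v w = S.metric ((extChartAt (𝓡 n) p).symm u)
      (coordFrame p ((extChartAt (𝓡 n) p).symm u) v)
      (coordFrame p ((extChartAt (𝓡 n) p).symm u) w) := rfl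

theorem coordMetric_symm (S : SpacetimeStructure n r M) (p : M) (u v w : 𝔼 n) :
    S.coordMetric p u v w = S.coordMetric p u w v :=
  S.symm_metric _ _ _

theorem mem_baseSet_of_mem_target {p : M} {u : 𝔼 n} (hu : u ∈ (extChartAt (𝓡 n) p).target) :
    (extChartAt (𝓡 n) p).symm u ∈
      (trivializationAt (𝔼 n) (TangentSpace (𝓡 n)) p).baseSet := by
  rw [TangentBundle.trivializationAt_baseSet, ← extChartAt_source (𝓡 n)]
  exact (extChartAt (𝓡 n) p).map_target hu

theorem coordFrame_coordTimeField (S : SpacetimeStructure n r M) {p : M} {u : 𝔼 n}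
    (hu : u ∈ (extChartAt (𝓡 n) p).target) :
    coordFrame p ((extChartAt (𝓡 n) p).symm u) (S.coordTimeField p u) =
      S.timeField ((extChartAt (𝓡 n) p).symm u) := by
  have hb := mem_baseSet_of_mem_target hu
  rw [coordFrame, coordTimeField]
  exact (Trivialization.symmL_apply _ hb _).trans
    ((trivializationAt (𝔼 n) (TangentSpace (𝓡 n)) p).symm_apply_apply_mk hb _)

theorem continuousAt_coordTimeField (S : SpacetimeStructure n r M) {p : M} {u : 𝔼 n}
    (hu : u ∈ (extChartAt (𝓡 n) p).target) : ContinuousAt (S.coordTimeField p) u := by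
  have hb := mem_baseSet_of_mem_target hu
  have h1 : ContinuousAt (extChartAt (𝓡 n) p).symm u := continuousAt_extChartAt_symm'' hu
  have h2 : ContinuousAt (fun u ↦ (⟨(extChartAt (𝓡 n) p).symm u,
      S.timeField ((extChartAt (𝓡 n) p).symm u)⟩ : TangentBundle (𝓡 n) M)) u :=
    S.continuous_timeField.continuousAt.comp h1
  have h3 : ContinuousAt (trivializationAt (𝔼 n) (TangentSpace (𝓡 n)) p)
      (⟨(extChartAt (𝓡 n) p).symm u,
      S.timeField ((extChartAt (𝓡 n) p).symm u)⟩ : TangentBundle (𝓡 n) M) := by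
    apply (trivializationAt (𝔼 n) (TangentSpace (𝓡 n)) p).toOpenPartialHomeomorph.continuousAt
    exact (Trivialization.mem_source _).2 hb
  exact continuousAt_snd.comp (h3.comp_of_eq h2 rfl)

/-- In finite dimension it suffices to test on fixed `v`, `w`; the entry is then a `C^1` metric
evaluated on two `C^1` frame fields. -/
theorem contDiffAt_coordMetric [IsManifold (𝓡 n) 2 M] (hr : 2 ≤ r) (S : SpacetimeStructure n r M)
    {p : M} {u : 𝔼 n} (hu : u ∈ (extChartAt (𝓡 n) p).target) :
    ContDiffAt ℝ 1 (S.coordMetric p) u := by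
  have ho : IsOpen (extChartAt (𝓡 n) p).target := isOpen_extChartAt_target p
  suffices h : ContDiffOn ℝ 1 (S.coordMetric p) (extChartAt (𝓡 n) p).target from
    h.contDiffAt (ho.mem_nhds hu)
  have hr1 : (1 : WithTop ℕ∞) ≤ ((r - 1 : ℕ∞) : WithTop ℕ∞) := by
    have : (1 : ℕ∞) ≤ r - 1 := by
      rw [show (2 : ℕ∞) = 1 + 1 by norm_num] at hr
      exact ENat.le_sub_of_add_le_left (by simp) hr
    exact_mod_cast this
  rw [contDiffOn_clm_apply]
  intro v
  rw [contDiffOn_clm_apply]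
  intro w
  -- The tangent bundle loses one derivative: its frames are `C^1` when `M` is `C^2`.
  have : IsManifold (𝓡 n) (1 + 1) M := by
    rwa [one_add_one_eq_two]
  have hframe : ∀ v : 𝔼 n, ContMDiffOn (𝓡 n) ((𝓡 n).prod 𝓘(ℝ, 𝔼 n)) 1
      (fun x : M ↦ TotalSpace.mk' (𝔼 n) (E := TangentSpace (𝓡 n)) x (coordFrame p x v))
      (trivializationAt (𝔼 n) (TangentSpace (𝓡 n)) p).baseSet := by
    intro v
    have h1 := (trivializationAt (𝔼 n) (TangentSpace (𝓡 n) (M := M)) p).contMDiffOn_symm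
      (IB := 𝓡 n) (n := 1)
    have h2 : ContMDiffOn (𝓡 n) ((𝓡 n).prod 𝓘(ℝ, 𝔼 n)) 1 (fun x : M ↦ (x, v))
        (trivializationAt (𝔼 n) (TangentSpace (𝓡 n)) p).baseSet :=
      (contMDiff_id.prodMk contMDiff_const).contMDiffOn
    refine (h1.comp h2 fun x hx ↦ ?_).congr fun x hx ↦ ?_
    · rw [Trivialization.target_eq]
      exact ⟨hx, trivial⟩
    · have := Trivialization.mk_symm (trivializationAt (𝔼 n) (TangentSpace (𝓡 n)) p) hx v
      rw [Function.comp_apply, ← this]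
      congr 1
      exact Trivialization.symmL_apply _ hx v
  have hmet := ((S.contMDiff_metric.of_le hr1).contMDiffOn
    (s := (trivializationAt (𝔼 n) (TangentSpace (𝓡 n) (M := M)) p).baseSet))
  have happ := ContMDiffOn.clm_bundle_apply₂ (F₁ := 𝔼 n) (F₂ := 𝔼 n) (F₃ := ℝ)
    (E₁ := fun x : M ↦ TangentSpace (𝓡 n) x) (E₂ := fun x : M ↦ TangentSpace (𝓡 n) x)
    (E₃ := fun _ : M ↦ ℝ) hmet (hframe v) (hframe w)
  have hscal : ContMDiffOn (𝓡 n) 𝓘(ℝ, ℝ) 1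
      (fun x : M ↦ S.metric x (coordFrame p x v) (coordFrame p x w))
      (trivializationAt (𝔼 n) (TangentSpace (𝓡 n) (M := M)) p).baseSet := by
    intro x hx
    have := happ x hx
    rw [contMDiffWithinAt_totalSpace] at this
    exact this.2
  exact (hscal.comp (contMDiffOn_extChartAt_symm p)
    fun u hu ↦ mem_baseSet_of_mem_target hu).contDiffOn

/-- Chain rule: the derivative of the inverse chart is the coordinate frame. -/
theorem mfderivWithin_chart_symm_comp {p : M} {c : ℝ → 𝔼 n} {s : Set ℝ} {t : ℝ}
    (hc : DifferentiableWithinAt ℝ c s t) (ht : c t ∈ (extChartAt (𝓡 n) p).target)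
    (hs : UniqueDiffWithinAt ℝ s t) :
    mfderivWithin 𝓘(ℝ, ℝ) (𝓡 n) ((extChartAt (𝓡 n) p).symm ∘ c) s t (1 : ℝ) =
      coordFrame p ((extChartAt (𝓡 n) p).symm (c t)) (derivWithin c s t) := by
  have hx : (extChartAt (𝓡 n) p).symm (c t) ∈ (chartAt (𝔼 n) p).source := by
    rw [← extChartAt_source (𝓡 n)]
    exact (extChartAt (𝓡 n) p).map_target ht
  have hg : MDifferentiableWithinAt 𝓘(ℝ, 𝔼 n) (𝓡 n) (extChartAt (𝓡 n) p).symm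
      (range (𝓡 n)) (c t) := mdifferentiableWithinAt_extChartAt_symm ht
  have h := mfderivWithin_comp (I := 𝓘(ℝ, ℝ)) (I' := 𝓘(ℝ, 𝔼 n)) (I'' := 𝓡 n) t hg
    hc.mdifferentiableWithinAt (fun _ _ ↦ by simp) hs.uniqueMDiffWithinAt
  rw [h, coordFrame, TangentBundle.symmL_trivializationAt hx, (extChartAt (𝓡 n) p).right_inv ht,
    mfderivWithin_eq_fderivWithin]
  rfl

/-- A `C^1` curve in the chart at `p` which is timelike in coordinates gives a timelike segment. -/
theorem isTimelikeSegment_chart_symm_comp (S : SpacetimeStructure n r M) {p : M} {c : ℝ → 𝔼 n}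
    {a b : ℝ} (hab : a < b) (hc : ContDiffOn ℝ 1 c (Icc a b))
    (h : ∀ t ∈ Icc a b, c t ∈ (extChartAt (𝓡 n) p).target ∧
      IsLocalTimelike (S.coordMetric p) (S.coordTimeField p) (c t) (derivWithin c (Icc a b) t)) :
    S.IsTimelikeSegment ((extChartAt (𝓡 n) p).symm ∘ c) a b := by
  refine ⟨hab, (contMDiffOn_extChartAt_symm p).comp hc.contMDiffOn fun t ht ↦ (h t ht).1,
    fun t ht ↦ ?_⟩
  obtain ⟨ht1, ht2, ht3⟩ := h t ht
  have hv : velocity n ((extChartAt (𝓡 n) p).symm ∘ c) a b t =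
      coordFrame p ((extChartAt (𝓡 n) p).symm (c t)) (derivWithin c (Icc a b) t) :=
    mfderivWithin_chart_symm_comp (hc.differentiableOn one_ne_zero t ht) ht1
      (uniqueDiffOn_Icc hab t ht)
  rw [hv]
  refine ⟨ht2, ?_⟩
  rw [coordMetric_apply, S.coordFrame_coordTimeField ht1] at ht3
  exact ht3

theorem contDiffOn_chart_comp {γ : ℝ → M} {p : M} {s : Set ℝ}
    (hγ : ContMDiffOn 𝓘(ℝ, ℝ) (𝓡 n) 1 γ s) (hs : MapsTo γ s (extChartAt (𝓡 n) p).source) :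
    ContDiffOn ℝ 1 (extChartAt (𝓡 n) p ∘ γ) s := by
  refine ContMDiffOn.contDiffOn (ContMDiffOn.comp (I' := 𝓡 n) contMDiffOn_extChartAt hγ
    fun t ht ↦ ?_)
  rw [← extChartAt_source (𝓡 n)]
  exact hs ht

theorem velocity_eq_coordFrame {γ : ℝ → M} {p : M} {a b : ℝ} (hab : a < b)
    (hγ : ContMDiffOn 𝓘(ℝ, ℝ) (𝓡 n) 1 γ (Icc a b))
    (hs : MapsTo γ (Icc a b) (extChartAt (𝓡 n) p).source) {t : ℝ} (ht : t ∈ Icc a b) :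
    velocity n γ a b t =
      coordFrame p (γ t) (derivWithin (extChartAt (𝓡 n) p ∘ γ) (Icc a b) t) := by
  have hc := contDiffOn_chart_comp hγ hs
  have hleft : ∀ t ∈ Icc a b, γ t = ((extChartAt (𝓡 n) p).symm ∘ extChartAt (𝓡 n) p ∘ γ) t :=
    fun t ht ↦ ((extChartAt (𝓡 n) p).left_inv (hs ht)).symm
  have h := mfderivWithin_chart_symm_comp (hc.differentiableOn one_ne_zero t ht)
    ((extChartAt (𝓡 n) p).map_source (hs ht)) (uniqueDiffOn_Icc hab t ht)
  rw [velocity, mfderivWithin_congr_of_mem hleft ht]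
  exact h.trans (congrArg (fun x ↦ coordFrame p x _) (hleft t ht).symm)

/-- Carries the causal character of a curve from `M` to coordinates;
`isTimelikeSegment_chart_symm_comp` goes the other way. -/
theorem coordMetric_chart_comp (S : SpacetimeStructure n r M) {γ : ℝ → M} {p : M} {a b : ℝ}
    (hab : a < b) (hγ : ContMDiffOn 𝓘(ℝ, ℝ) (𝓡 n) 1 γ (Icc a b))
    (hs : MapsTo γ (Icc a b) (extChartAt (𝓡 n) p).source) {t : ℝ} (ht : t ∈ Icc a b) :
    S.coordMetric p (extChartAt (𝓡 n) p (γ t))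
        (derivWithin (extChartAt (𝓡 n) p ∘ γ) (Icc a b) t)
        (derivWithin (extChartAt (𝓡 n) p ∘ γ) (Icc a b) t) =
        S.metric (γ t) (velocity n γ a b t) (velocity n γ a b t) ∧
      S.coordMetric p (extChartAt (𝓡 n) p (γ t))
        (derivWithin (extChartAt (𝓡 n) p ∘ γ) (Icc a b) t)
        (S.coordTimeField p (extChartAt (𝓡 n) p (γ t))) =
        S.metric (γ t) (velocity n γ a b t) (S.timeField (γ t)) := by
  rw [velocity_eq_coordFrame hab hγ hs ht, coordMetric_apply, coordMetric_apply,
    S.coordFrame_coordTimeField ((extChartAt (𝓡 n) p).map_source (hs ht)),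
    (extChartAt (𝓡 n) p).left_inv (hs ht)]
  exact ⟨rfl, rfl⟩

theorem coordMetric_coordTimeField_neg (S : SpacetimeStructure n r M) {p : M} {u : 𝔼 n}
    (hu : u ∈ (extChartAt (𝓡 n) p).target) :
    S.coordMetric p u (S.coordTimeField p u) (S.coordTimeField p u) < 0 := by
  rw [coordMetric_apply, S.coordFrame_coordTimeField hu]
  exact S.timelike_timeField _

end Coordinates

/-! ### Cutting, reparametrizing and concatenating segments -/

section Segments

variable {n : ℕ} {r : ℕ∞} {M : Type*} [TopologicalSpace M]
  [ChartedSpace (EuclideanSpace ℝ (Fin n)) M]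

theorem velocity_restrict {γ : ℝ → M} {a b a' b' t : ℝ}
    (hγ : ContMDiffOn 𝓘(ℝ, ℝ) (𝓡 n) 1 γ (Icc a b)) (h : a' < b') (ha : a ≤ a') (hb : b' ≤ b)
    (ht : t ∈ Icc a' b') : velocity n γ a' b' t = velocity n γ a b t := by
  have hsub : Icc a' b' ⊆ Icc a b := Icc_subset_Icc ha hb
  rw [velocity, velocity, mfderivWithin_subset hsub
    (uniqueDiffOn_Icc h t ht).uniqueMDiffWithinAt
    ((hγ t (hsub ht)).mdifferentiableWithinAt one_ne_zero)]

theorem velocity_congr {γ γ' : ℝ → M} {a b t : ℝ} (h : EqOn γ γ' (Icc a b)) (ht : t ∈ Icc a b) :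
    velocity n γ a b t = velocity n γ' a b t := by
  rw [velocity, velocity, mfderivWithin_congr_of_mem h ht]
  rfl

/-- Used with `k = 1` for translations and `k = -1` for time reversal. -/
theorem velocity_comp_affine {γ : ℝ → M} {f : ℝ → ℝ} {k a b a' b' t : ℝ}
    (hγ : ContMDiffOn 𝓘(ℝ, ℝ) (𝓡 n) 1 γ (Icc a b)) (hab : a' < b')
    (hf : ∀ s, HasDerivAt f k s) (hmaps : MapsTo f (Icc a' b') (Icc a b)) (ht : t ∈ Icc a' b') :
    velocity n (γ ∘ f) a' b' t = k • velocity n γ a b (f t) := by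
  have hd : MDifferentiableWithinAt 𝓘(ℝ, ℝ) 𝓘(ℝ, ℝ) f (Icc a' b') t :=
    (hf t).differentiableAt.differentiableWithinAt.mdifferentiableWithinAt
  have h := mfderivWithin_comp (I := 𝓘(ℝ, ℝ)) (I' := 𝓘(ℝ, ℝ)) (I'' := 𝓡 n) t
    ((hγ _ (hmaps ht)).mdifferentiableWithinAt one_ne_zero) hd hmaps
    (uniqueDiffOn_Icc hab t ht).uniqueMDiffWithinAt
  rw [velocity, velocity, h, mfderivWithin_eq_fderivWithin]
  have h2 : fderivWithin ℝ f (Icc a' b') t (1 : ℝ) = k • (1 : ℝ) := by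
    rw [fderivWithin_derivWithin,
      (hf t).hasDerivWithinAt.derivWithin (uniqueDiffOn_Icc hab t ht)]
    simp
  refine (congrArg (mfderivWithin 𝓘(ℝ, ℝ) (𝓡 n) γ (Icc a b) (f t)) h2).trans ?_
  exact map_smul (mfderivWithin 𝓘(ℝ, ℝ) (𝓡 n) γ (Icc a b) (f t)) k (1 : ℝ)

variable [IsManifold (𝓡 n) 1 M] {S : SpacetimeStructure n r M}

theorem IsTimelikeSegment.restrict {γ : ℝ → M} {a b a' b' : ℝ} (hγ : S.IsTimelikeSegment γ a b)
    (h : a' < b') (ha : a ≤ a') (hb : b' ≤ b) : S.IsTimelikeSegment γ a' b' := by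
  refine ⟨h, hγ.contMDiffOn.mono (Icc_subset_Icc ha hb), fun t ht ↦ ?_⟩
  rw [velocity_restrict hγ.contMDiffOn h ha hb ht]
  exact hγ.future t (Icc_subset_Icc ha hb ht)

theorem IsCausalSegment.restrict {γ : ℝ → M} {a b a' b' : ℝ} (hγ : S.IsCausalSegment γ a b)
    (h : a' < b') (ha : a ≤ a') (hb : b' ≤ b) : S.IsCausalSegment γ a' b' := by
  refine ⟨h, hγ.contMDiffOn.mono (Icc_subset_Icc ha hb), fun t ht ↦ ?_⟩
  rw [velocity_restrict hγ.contMDiffOn h ha hb ht]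
  exact hγ.future t (Icc_subset_Icc ha hb ht)

theorem isFutureTimelike_of_eq {x y : M} (h : x = y) {v : EuclideanSpace ℝ (Fin n)}
    (hv : S.IsFutureTimelike (x := x) v) : S.IsFutureTimelike (x := y) v := by
  subst h
  exact hv

theorem IsTimelikeSegment.congr {γ γ' : ℝ → M} {a b : ℝ} (hγ : S.IsTimelikeSegment γ a b)
    (h : EqOn γ' γ (Icc a b)) : S.IsTimelikeSegment γ' a b := by
  refine ⟨hγ.lt, hγ.contMDiffOn.congr h, fun t ht ↦ ?_⟩
  rw [velocity_congr h ht]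
  exact isFutureTimelike_of_eq (h ht).symm (hγ.future t ht)

theorem IsTimelikeSegment.comp_add_const {γ : ℝ → M} {a b : ℝ} (hγ : S.IsTimelikeSegment γ a b)
    (k : ℝ) : S.IsTimelikeSegment (γ ∘ fun t ↦ t + k) (a - k) (b - k) := by
  have hab : a - k < b - k := by linarith [hγ.lt]
  have hmaps : MapsTo (fun t ↦ t + k) (Icc (a - k) (b - k)) (Icc a b) :=
    fun t ht ↦ ⟨by linarith [ht.1], by linarith [ht.2]⟩
  refine ⟨hab, hγ.contMDiffOn.comp (ContDiff.contMDiff (by fun_prop)).contMDiffOn hmaps,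
    fun t ht ↦ ?_⟩
  rw [velocity_comp_affine hγ.contMDiffOn hab (fun s ↦ (hasDerivAt_id' s).add_const k) hmaps ht,
    one_smul]
  exact hγ.future _ (hmaps ht)

/-- The conjunct `a < b` is carried along because the induction needs it to restrict the agreement
to the last piece. -/
theorem IsTimelikeCurve.congr {γ γ' : ℝ → M} {a b : ℝ} (hγ : S.IsTimelikeCurve γ a b)
    (h : EqOn γ' γ (Icc a b)) : a < b ∧ S.IsTimelikeCurve γ' a b := by
  induction hγ with
  | single hs => exact ⟨hs.lt, .single (hs.congr h)⟩
  | append _ hs ih =>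
    obtain ⟨hab, ih⟩ := ih (h.mono (Icc_subset_Icc_right hs.lt.le))
    exact ⟨hab.trans hs.lt, ih.append (hs.congr (h.mono (Icc_subset_Icc_left hab.le)))⟩

/-- The relation `x ≪ y` given by a single `C^1` timelike segment. -/
def TimelikeStep (S : SpacetimeStructure n r M) (x y : M) : Prop :=
  ∃ (γ : ℝ → M) (a b : ℝ), S.IsTimelikeSegment γ a b ∧ γ a = x ∧ γ b = y

/-- The relation given by a single `C^1` causal segment. -/
def CausalStep (S : SpacetimeStructure n r M) (x y : M) : Prop :=
  ∃ (γ : ℝ → M) (a b : ℝ), S.IsCausalSegment γ a b ∧ γ a = x ∧ γ b = y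

/-- Translating parameters lets pieces be glued, so chains of segments replace piecewise curves;
transitivity and time reversal become formal. -/
theorem mem_chronRel_iff {x y : M} :
    (x, y) ∈ S.chronRel ↔ Relation.TransGen S.TimelikeStep x y := by
  constructor
  · rintro ⟨γ, a, b, hγ, rfl, rfl⟩
    induction hγ with
    | single hs => exact .single ⟨γ, _, _, hs, rfl, rfl⟩
    | append _ hs ih => exact ih.tail ⟨γ, _, _, hs, rfl, rfl⟩
  · intro h
    induction h with
    | single hs =>
      obtain ⟨γ, a, b, hs, rfl, rfl⟩ := hs
      exact ⟨γ, a, b, .single hs, rfl, rfl⟩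
    | tail _ hs ih =>
      obtain ⟨γ, a, b, hγ, rfl, h1⟩ := ih
      obtain ⟨γ', a', b', hs, rfl, rfl⟩ := hs
      dsimp only at h1
      -- The shift makes the new piece start at parameter `b`. There the glued curve uses `γ`, which
      -- agrees with `γ'` by `h1`.
      have hγ' := hs.comp_add_const (a' - b)
      have h2 : EqOn (fun t ↦ if t ≤ b then γ t else γ' (t + (a' - b))) γ (Icc a b) :=
        fun t ht ↦ if_pos ht.2
      have h3 : EqOn (fun t ↦ if t ≤ b then γ t else γ' (t + (a' - b)))
          (γ' ∘ fun t ↦ t + (a' - b)) (Icc (a' - (a' - b)) (b' - (a' - b))) := by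
        intro t ht
        rw [sub_sub_cancel] at ht
        rcases ht.1.eq_or_lt with rfl | hlt
        · simp [h1]
        · simp [hlt.not_ge]
      obtain ⟨hab, hγ''⟩ := hγ.congr h2
      have hs' := hγ'.congr h3
      rw [sub_sub_cancel] at hs'
      refine ⟨_, a, _, hγ''.append hs', by simp [hab.le], ?_⟩
      have := hs'.lt
      dsimp only
      rw [if_neg this.not_ge, sub_add_cancel]

theorem IsCausalCurve.transGen {γ : ℝ → M} {a b : ℝ} (hγ : S.IsCausalCurve γ a b) :
    Relation.TransGen S.CausalStep (γ a) (γ b) := by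
  induction hγ with
  | single hs => exact .single ⟨γ, _, _, hs, rfl, rfl⟩
  | append _ hs ih => exact ih.tail ⟨γ, _, _, hs, rfl, rfl⟩

theorem chronRel_trans {x y z : M} (h1 : (x, y) ∈ S.chronRel) (h2 : (y, z) ∈ S.chronRel) :
    (x, z) ∈ S.chronRel := by
  rw [mem_chronRel_iff] at *
  exact h1.trans h2

/-! ### Time reversal, and nonconstancy of causal segments -/

/-- The spacetime with the opposite time orientation. -/
noncomputable def reverse (S : SpacetimeStructure n r M) : SpacetimeStructure n r M where
  metric := S.metric
  contMDiff_metric := S.contMDiff_metric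
  symm_metric := S.symm_metric
  lorentzian := S.lorentzian
  timeField x := -S.timeField x
  continuous_timeField := by
    rw [continuous_iff_continuousAt]
    intro x
    have h := (S.continuous_timeField.continuousAt (x := x))
    rw [FiberBundle.continuousAt_totalSpace] at h ⊢
    refine ⟨h.1, ?_⟩
    refine h.2.neg.congr ?_
    -- Near `x` the trivialization is linear on fibres, hence commutes with negation.
    filter_upwards [(trivializationAt (EuclideanSpace ℝ (Fin n)) (TangentSpace (𝓡 n))
      x).open_baseSet.mem_nhds (mem_baseSet_trivializationAt _ _ x)] with y hy
    exact ((Trivialization.linear ℝ (trivializationAt (EuclideanSpace ℝ (Fin n))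
      (TangentSpace (𝓡 n)) x) hy).mk' _ |>.map_neg (S.timeField y)).symm
  timelike_timeField x := by
    simpa using S.timelike_timeField x

theorem reverse_reverse : S.reverse.reverse = S := by
  cases S
  simp [reverse]

theorem IsFutureTimelike.reverse {x : M} {v : TangentSpace (𝓡 n) x} (h : S.IsFutureTimelike v) :
    S.reverse.IsFutureTimelike ((-1 : ℝ) • v) := by
  refine ⟨?_, ?_⟩
  · simpa [SpacetimeStructure.reverse] using h.1
  · simpa [SpacetimeStructure.reverse] using h.2

theorem IsFutureCausal.reverse {x : M} {v : TangentSpace (𝓡 n) x} (h : S.IsFutureCausal v) :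
    S.reverse.IsFutureCausal ((-1 : ℝ) • v) := by
  refine ⟨?_, ?_, ?_⟩
  · simpa using h.1
  · simpa [SpacetimeStructure.reverse] using h.2.1
  · simpa [SpacetimeStructure.reverse] using h.2.2

theorem IsTimelikeSegment.reverse {γ : ℝ → M} {a b : ℝ} (hγ : S.IsTimelikeSegment γ a b) :
    S.reverse.IsTimelikeSegment (γ ∘ fun t ↦ -t) (-b) (-a) := by
  have hab : -b < -a := neg_lt_neg hγ.lt
  have hmaps : MapsTo (fun t ↦ -t) (Icc (-b) (-a)) (Icc a b) :=
    fun t ht ↦ ⟨by linarith [ht.2], by linarith [ht.1]⟩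
  refine ⟨hab, hγ.contMDiffOn.comp (ContDiff.contMDiff (by fun_prop)).contMDiffOn hmaps,
    fun t ht ↦ ?_⟩
  rw [velocity_comp_affine hγ.contMDiffOn hab (fun s ↦ hasDerivAt_neg' s) hmaps ht]
  exact (hγ.future _ (hmaps ht)).reverse

theorem IsCausalSegment.reverse {γ : ℝ → M} {a b : ℝ} (hγ : S.IsCausalSegment γ a b) :
    S.reverse.IsCausalSegment (γ ∘ fun t ↦ -t) (-b) (-a) := by
  have hab : -b < -a := neg_lt_neg hγ.lt
  have hmaps : MapsTo (fun t ↦ -t) (Icc (-b) (-a)) (Icc a b) :=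
    fun t ht ↦ ⟨by linarith [ht.2], by linarith [ht.1]⟩
  refine ⟨hab, hγ.contMDiffOn.comp (ContDiff.contMDiff (by fun_prop)).contMDiffOn hmaps,
    fun t ht ↦ ?_⟩
  rw [velocity_comp_affine hγ.contMDiffOn hab (fun s ↦ hasDerivAt_neg' s) hmaps ht]
  exact (hγ.future _ (hmaps ht)).reverse

theorem TimelikeStep.reverse {x y : M} (h : S.TimelikeStep x y) :
    S.reverse.TimelikeStep y x := by
  obtain ⟨γ, a, b, hγ, rfl, rfl⟩ := h
  exact ⟨_, _, _, hγ.reverse, by simp, by simp⟩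

theorem CausalStep.reverse {x y : M} (h : S.CausalStep x y) :
    S.reverse.CausalStep y x := by
  obtain ⟨γ, a, b, hγ, rfl, rfl⟩ := h
  exact ⟨_, _, _, hγ.reverse, by simp, by simp⟩

theorem mem_chronRel_reverse {x y : M} : (x, y) ∈ S.reverse.chronRel ↔ (y, x) ∈ S.chronRel := by
  -- Proved for all `S`, so that applying it to `S.reverse` yields the converse.
  have key : ∀ {S : SpacetimeStructure n r M} {x y : M},
      (x, y) ∈ S.chronRel → (y, x) ∈ S.reverse.chronRel := by
    intro S x y h
    rw [mem_chronRel_iff] at *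
    exact Relation.TransGen.mono (fun _ _ h ↦ TimelikeStep.reverse h) _ _
      (Relation.transGen_swap.2 h)
  exact ⟨fun h ↦ by simpa only [reverse_reverse] using key h, key⟩

theorem chronFuture_reverse (x : M) : S.reverse.chronFuture x = S.chronPast x :=
  Set.ext fun _ ↦ mem_chronRel_reverse

theorem reflTransGen_causalStep_reverse {x y : M} (h : Relation.ReflTransGen S.CausalStep x y) :
    Relation.ReflTransGen S.reverse.CausalStep y x :=
  Relation.ReflTransGen.mono (fun _ _ h ↦ CausalStep.reverse h) _ _
    (Relation.reflTransGen_swap.2 h)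

/-- Otherwise the velocity at `a` would vanish. The parameter is interior so that the segment can be
cut there into two. -/
theorem IsCausalSegment.exists_ne {γ : ℝ → M} {a b : ℝ} (hγ : S.IsCausalSegment γ a b) :
    ∃ t ∈ Ioo a b, γ t ≠ γ a := by
  by_contra! hconst
  obtain ⟨s, has, hsb⟩ := exists_between hγ.lt
  have hγ' := hγ.restrict has le_rfl hsb.le
  have hEq : EqOn γ (fun _ ↦ γ a) (Icc a s) := by
    intro t ht
    rcases ht.1.eq_or_lt with rfl | h
    · rfl
    · exact hconst t ⟨h, ht.2.trans_lt hsb⟩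
  have ha := left_mem_Icc.2 has.le
  refine (hγ'.future a ha).1 ?_
  rw [velocity_congr hEq ha, velocity, mfderivWithin_const]
  rfl

end Segments

/-! ### Push-up, openness and the causal ladder -/

section CausalRelations

variable {n : ℕ} {r : ℕ∞} {M : Type*} [TopologicalSpace M]
  [ChartedSpace (EuclideanSpace ℝ (Fin n)) M] [IsManifold (𝓡 n) 1 M] [IsManifold (𝓡 n) 2 M]
  {S : SpacetimeStructure n r M}

/-- A short straight coordinate line in the direction of the time field is timelike. -/
theorem mem_closure_chronFuture_self (hr : 2 ≤ r) (x : M) : x ∈ closure (S.chronFuture x) := by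
  have hu : extChartAt (𝓡 n) x x ∈ (extChartAt (𝓡 n) x).target := mem_extChartAt_target x
  have hT : IsLocalTimelike (S.coordMetric x) (S.coordTimeField x) (extChartAt (𝓡 n) x x)
      (S.coordTimeField x (extChartAt (𝓡 n) x x)) :=
    ⟨S.coordMetric_coordTimeField_neg hu, S.coordMetric_coordTimeField_neg hu⟩
  set T := S.coordTimeField x (extChartAt (𝓡 n) x x)
  set u := extChartAt (𝓡 n) x x with hudef
  have hev := hT.eventually (S.contDiffAt_coordMetric hr hu).continuousAt
    (S.continuousAt_coordTimeField hu)
  rw [mem_closure_iff_nhds]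
  intro V hV
  have hc : Continuous fun t : ℝ ↦ u + t • T := by fun_prop
  have hc0 : Tendsto (fun t : ℝ ↦ u + t • T) (𝓝 0) (𝓝 u) := by
    simpa using hc.tendsto 0
  have hV' : (extChartAt (𝓡 n) x).symm ⁻¹' V ∈ 𝓝 u := by
    refine (continuousAt_extChartAt_symm'' hu).preimage_mem_nhds ?_
    rwa [hudef, extChartAt_to_inv]
  obtain ⟨η, hη, h⟩ := Metric.eventually_nhds_iff.1
    (((hc0.eventually ((isOpen_extChartAt_target x).mem_nhds hu)).and
      ((hc0.prodMk_nhds (tendsto_const_nhds (x := T))).eventually hev)).and (hc0.eventually hV'))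
  have h' : ∀ t ∈ Icc 0 (η / 2), dist t 0 < η := fun t ht ↦ by
    rw [Real.dist_eq, sub_zero, abs_of_nonneg ht.1]
    linarith [ht.2]
  have hη2 : 0 < η / 2 := half_pos hη
  have hseg : S.IsTimelikeSegment ((extChartAt (𝓡 n) x).symm ∘ fun t : ℝ ↦ u + t • T)
      0 (η / 2) := by
    refine S.isTimelikeSegment_chart_symm_comp hη2 (ContDiff.contDiffOn (by fun_prop))
      fun t ht ↦ ⟨(h (h' t ht)).1.1, ?_⟩
    have hd : HasDerivAt (fun t : ℝ ↦ u + t • T) T t := by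
      simpa using ((hasDerivAt_id t).smul_const T).const_add u
    rw [hd.hasDerivWithinAt.derivWithin (uniqueDiffOn_Icc hη2 t ht)]
    exact (h (h' t ht)).1.2
  refine ⟨_, (h (h' (η / 2) (right_mem_Icc.2 hη2.le))).2, ?_⟩
  refine mem_chronRel_iff.2 (.single ⟨_, _, _, hseg, ?_, rfl⟩)
  simp [hudef]

/-- Only the end of the last segment has to change, inside a chart around the endpoint. -/
theorem isOpen_chronFuture (hr : 2 ≤ r) (x : M) : IsOpen (S.chronFuture x) := by
  rw [isOpen_iff_mem_nhds]
  intro y hy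
  obtain ⟨z, hxz, γ, a, b, hγ, rfl, rfl⟩ :=
    Relation.TransGen.tail'_iff.1 (mem_chronRel_iff.1 hy)
  set p := γ b with hp
  have hsrc : (extChartAt (𝓡 n) p).source ∈ 𝓝 (γ b) := extChartAt_source_mem_nhds p
  obtain ⟨η, hη, hnear⟩ := Metric.mem_nhdsWithin_iff.1
    (hγ.contMDiffOn.continuousOn b (right_mem_Icc.2 hγ.lt.le) hsrc)
  obtain ⟨a', ha1, ha2⟩ := exists_between (max_lt hγ.lt (sub_lt_self b hη))
  have haa : a < a' := (le_max_left _ _).trans_lt ha1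
  have hmaps : MapsTo γ (Icc a' b) (extChartAt (𝓡 n) p).source := fun t ht ↦ hnear ⟨by
    rw [Metric.mem_ball, Real.dist_eq, abs_sub_comm, abs_of_nonneg (by linarith [ht.2])]
    linarith [ht.1, le_max_right a (b - η)], by linarith [ht.1], ht.2⟩
  have hγ' := hγ.restrict ha2 haa.le le_rfl
  have hb := right_mem_Icc.2 ha2.le
  have hu : extChartAt (𝓡 n) p (γ b) ∈ (extChartAt (𝓡 n) p).target :=
    (extChartAt (𝓡 n) p).map_source (hmaps hb)
  obtain ⟨e1, e2⟩ := S.coordMetric_chart_comp ha2 hγ'.contMDiffOn hmaps hb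
  obtain ⟨s, hs, hev⟩ := exists_timelike_to_nearby_endpoint (c := extChartAt (𝓡 n) p ∘ γ)
    (G := S.coordMetric p) (τ := S.coordTimeField p) ha2
    ((isOpen_extChartAt_target p).mem_nhds hu) (S.contDiffAt_coordMetric hr hu).continuousAt
    (S.continuousAt_coordTimeField hu) (contDiffOn_chart_comp hγ'.contMDiffOn hmaps)
    ⟨e1.trans_lt (hγ'.future b hb).1, e2.trans_lt (hγ'.future b hb).2⟩
  filter_upwards [hsrc, (continuousAt_extChartAt p).eventually hev] with q hq
    ⟨σ, hσ, hσs, hσb, hσt⟩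
  have hseg := S.isTimelikeSegment_chart_symm_comp hs.2 hσ hσt
  have has : a < s := haa.trans hs.1
  refine mem_chronRel_iff.2 ((Relation.TransGen.tail' hxz
    ⟨γ, a, s, hγ.restrict has le_rfl hs.2.le, rfl, rfl⟩).tail ⟨_, _, _, hseg, ?_, ?_⟩)
  · rw [Function.comp_apply, hσs]
    exact (extChartAt (𝓡 n) p).left_inv (hmaps ⟨hs.1.le, hs.2.le⟩)
  · rw [Function.comp_apply, hσb]
    exact (extChartAt (𝓡 n) p).left_inv hq

/-- Points of `I⁺(x)` close to `γ a` serve as initial points of the perturbed timelike curves, which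
end arbitrarily close to `γ t`. -/
theorem IsCausalSegment.eventually_mem_closure_chronFuture (hr : 2 ≤ r) {γ : ℝ → M} {a b : ℝ}
    (hγ : S.IsCausalSegment γ a b) {x : M} (hx : γ a ∈ closure (S.chronFuture x)) :
    ∀ᶠ t in 𝓝[>] a, γ t ∈ closure (S.chronFuture x) := by
  set p := γ a with hp
  have hsrc : (extChartAt (𝓡 n) p).source ∈ 𝓝 (γ a) := extChartAt_source_mem_nhds p
  obtain ⟨η, hη, hnear⟩ := Metric.mem_nhdsWithin_iff.1
    (hγ.contMDiffOn.continuousOn a (left_mem_Icc.2 hγ.lt.le) hsrc)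
  obtain ⟨b', hb1, hb2⟩ := exists_between (lt_min hγ.lt (lt_add_of_pos_right a hη))
  have hbb : b' < b := hb2.trans_le (min_le_left _ _)
  have hmaps : MapsTo γ (Icc a b') (extChartAt (𝓡 n) p).source := fun t ht ↦ hnear ⟨by
    rw [Metric.mem_ball, Real.dist_eq, abs_of_nonneg (by linarith [ht.1])]
    linarith [ht.2, min_le_right b (a + η)], ht.1, by linarith [ht.2]⟩
  have hγ' := hγ.restrict hb1 le_rfl hbb.le
  have ha := left_mem_Icc.2 hb1.le
  have hu : extChartAt (𝓡 n) p (γ a) ∈ (extChartAt (𝓡 n) p).target :=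
    (extChartAt (𝓡 n) p).map_source (hmaps ha)
  have hloc := exists_timelike_near_causal (c := extChartAt (𝓡 n) p ∘ γ)
    (G := S.coordMetric p) (τ := S.coordTimeField p) hb1
    ((isOpen_extChartAt_target p).mem_nhds hu) (S.contDiffAt_coordMetric hr hu)
    (S.continuousAt_coordTimeField hu) (fun u _ ↦ S.coordMetric_symm p u)
    (S.coordMetric_coordTimeField_neg hu) (contDiffOn_chart_comp hγ'.contMDiffOn hmaps)
    (fun t ht ↦ (S.coordMetric_chart_comp hb1 hγ'.contMDiffOn hmaps ht).1.trans_le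
      (hγ'.future t ht).2.1)
    ((S.coordMetric_chart_comp hb1 hγ'.contMDiffOn hmaps ha).2.trans_lt (hγ'.future a ha).2.2)
  filter_upwards [hloc, Ioo_mem_nhdsGT hb1] with t ht htb
  have hts : γ t ∈ (extChartAt (𝓡 n) p).source := hmaps ⟨htb.1.le, htb.2.le⟩
  rw [mem_closure_iff_nhds]
  intro V hV
  have hV' : (extChartAt (𝓡 n) p).symm ⁻¹' V ∈ 𝓝 (extChartAt (𝓡 n) p (γ t)) := by
    refine (continuousAt_extChartAt_symm'' ((extChartAt (𝓡 n) p).map_source hts)).preimage_mem_nhds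
      ?_
    rwa [(extChartAt (𝓡 n) p).left_inv hts]
  obtain ⟨ε, hε, hεV⟩ := Metric.mem_nhds_iff.1 hV'
  obtain ⟨δ, hδ, hδσ⟩ := ht ε hε
  have hnb : ∀ᶠ z in 𝓝 (γ a), z ∈ (extChartAt (𝓡 n) p).source ∧
      ‖extChartAt (𝓡 n) p z - extChartAt (𝓡 n) p (γ a)‖ < δ := by
    refine (eventually_mem_set.2 hsrc).and ?_
    filter_upwards [(continuousAt_extChartAt (I := 𝓡 n) p).preimage_mem_nhds (Metric.ball_mem_nhds _ hδ)]
      with z hz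
    simpa [dist_eq_norm] using hz
  obtain ⟨z, ⟨hz1, hz2⟩, hz3⟩ := mem_closure_iff_nhds.1 hx _ hnb
  obtain ⟨σ, hσ, hσa, hσt, hσtl⟩ := hδσ _ hz2
  have hseg := S.isTimelikeSegment_chart_symm_comp htb.1 hσ hσtl
  refine ⟨(extChartAt (𝓡 n) p).symm (σ t), hεV (by simpa [dist_eq_norm] using hσt), ?_⟩
  refine mem_chronRel_iff.2 ((mem_chronRel_iff.1 hz3).tail ⟨_, _, _, hseg, ?_, rfl⟩)
  rw [Function.comp_apply, hσa]
  exact (extChartAt (𝓡 n) p).left_inv hz1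

/-- Continuous induction: the good parameters form a closed set containing `a`, and the local result
extends it to the right of each of its points before `b`. -/
theorem IsCausalSegment.mem_closure_chronFuture (hr : 2 ≤ r) {γ : ℝ → M} {a b : ℝ}
    (hγ : S.IsCausalSegment γ a b) {x : M} (hx : γ a ∈ closure (S.chronFuture x)) :
    γ b ∈ closure (S.chronFuture x) := by
  have hsub : Icc a b ⊆ γ ⁻¹' closure (S.chronFuture x) := by
    refine IsClosed.Icc_subset_of_forall_exists_gt ?_ hx ?_
    · rw [inter_comm]
      exact hγ.contMDiffOn.continuousOn.preimage_isClosed_of_isClosed isClosed_Icc isClosed_closure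
    · rintro t ⟨ht, hat, htb⟩ s hs
      have hev := (hγ.restrict htb hat le_rfl).eventually_mem_closure_chronFuture hr ht
      exact (hev.and (Ioc_mem_nhdsGT hs)).exists
  exact hsub (right_mem_Icc.2 hγ.lt.le)

theorem mem_closure_chronFuture_of_causal (hr : 2 ≤ r) {x y : M}
    (h : Relation.ReflTransGen S.CausalStep x y) : y ∈ closure (S.chronFuture x) := by
  induction h with
  | refl => exact mem_closure_chronFuture_self hr x
  | tail _ hs ih =>
    obtain ⟨γ, a, b, hγ, rfl, rfl⟩ := hs
    exact hγ.mem_closure_chronFuture hr ih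

theorem mem_closure_chronPast_of_causal (hr : 2 ≤ r) {x y : M}
    (h : Relation.ReflTransGen S.CausalStep x y) : x ∈ closure (S.chronPast y) := by
  rw [← chronFuture_reverse]
  exact mem_closure_chronFuture_of_causal hr (reflTransGen_causalStep_reverse h)

/-- The causal relation lies in `D⁺`. -/
theorem causalRel_subset_dRel (hr : 2 ≤ r) : S.causalRel ⊆ S.dRel := by
  rintro ⟨x, y⟩ h
  have h' : Relation.ReflTransGen S.CausalStep x y := by
    rcases h with h | ⟨γ, a, b, hγ, h1, h2⟩
    · obtain rfl : x = y := h
      exact .refl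
    · dsimp only at h1 h2
      rw [← h1, ← h2]
      exact hγ.transGen.to_reflTransGen
  exact ⟨mem_closure_chronPast_of_causal hr h', mem_closure_chronFuture_of_causal hr h'⟩

/-- Moving to the causal future shrinks the chronological future. -/
theorem chronFuture_subset_of_causal (hr : 2 ≤ r) {x y : M}
    (h : Relation.ReflTransGen S.CausalStep x y) : S.chronFuture y ⊆ S.chronFuture x := by
  intro z hz
  -- `I⁻(z)` is a neighbourhood of `y`, so it contains some `w` with `x ≪ w ≪ z`.
  have hopen : IsOpen (S.chronPast z) := by
    rw [← chronFuture_reverse]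
    exact isOpen_chronFuture hr z
  obtain ⟨w, hw1, hw2⟩ := mem_closure_iff.1 (mem_closure_chronFuture_of_causal hr h) _ hopen hz
  exact chronRel_trans hw2 hw1

theorem chronPast_subset_of_causal (hr : 2 ≤ r) {x y : M}
    (h : Relation.ReflTransGen S.CausalStep x y) : S.chronPast x ⊆ S.chronPast y := by
  rw [← chronFuture_reverse, ← chronFuture_reverse]
  exact chronFuture_subset_of_causal hr (reflTransGen_causalStep_reverse h)

/-- On a closed causal curve any two points precede each other, so monotonicity of `I⁺` and `I⁻`
holds both ways; the first segment supplies two distinct points. -/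
theorem FeeblyDistinguishing.causal (hr : 2 ≤ r) (hS : S.FeeblyDistinguishing) : S.Causal := by
  rintro ⟨γ, a, b, hγ, hab⟩
  obtain ⟨z, ⟨γ', a', b', hγ', h1, h2⟩, hz⟩ := Relation.TransGen.head'_iff.1 hγ.transGen
  obtain ⟨t, ht, hne⟩ := hγ'.exists_ne
  have hseg1 := hγ'.restrict ht.1 le_rfl ht.2.le
  have hseg2 := hγ'.restrict ht.2 ht.1.le le_rfl
  have hforth : Relation.ReflTransGen S.CausalStep (γ' a') (γ' t) :=
    .single ⟨_, _, _, hseg1, rfl, rfl⟩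
  -- Finish the first segment, then follow the rest of the loop back to its start.
  have hback : Relation.ReflTransGen S.CausalStep (γ' t) (γ' a') := by
    refine .head ⟨_, _, _, hseg2, rfl, rfl⟩ ?_
    rwa [h1, h2, hab]
  exact hne (hS (γ' a') (γ' t) (.inr ⟨_, _, _, .single hseg1, rfl, rfl⟩)
    ((chronFuture_subset_of_causal hr hback).antisymm (chronFuture_subset_of_causal hr hforth))
    ((chronPast_subset_of_causal hr hforth).antisymm (chronPast_subset_of_causal hr hback))).symm

end CausalRelations

end SpacetimeStructure

theorem mainTheorem5 (n : ℕ) (hn : 2 ≤ n) (r : ℕ∞) (hr : 3 ≤ r)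
    (M : Type*) [TopologicalSpace M] [T2Space M] [SecondCountableTopology M] [ConnectedSpace M]
    [ChartedSpace (EuclideanSpace ℝ (Fin n)) M] [IsManifold (𝓡 n) 1 M]
    [IsManifold (𝓡 n) (r : WithTop ℕ∞) M]
    (S : SpacetimeStructure n r M) :
    S.causalRel ⊆ S.dRel ∧
      (S.WeaklyDistinguishing → S.FeeblyDistinguishing) ∧
      (S.FeeblyDistinguishing → S.Causal) := by
  have hr2 : 2 ≤ r := le_trans (by norm_num) hr
  have : IsManifold (𝓡 n) 2 M := IsManifold.of_le (n := (r : WithTop ℕ∞)) (WithTop.coe_le_coe.2 hr2)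
  exact ⟨SpacetimeStructure.causalRel_subset_dRel hr2, fun h x y _ ↦ h x y, fun h ↦ h.causal hr2⟩
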